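/- For positive integers $m,k$, let the generalized Schur number $S(m,k)=R_k(x_1+\cdots+x_{m-1}=x_m)$ be the smallest positive integer $n$ such that for every coloring of $\{1,2,\dots,n\}$ with $k$ colors there are $x_1,\dots,x_m\in\{1,\dots,n\}$, not necessarily distinct and all of the same color, with $x_1+\cdots+x_{m-1}=x_m$ (and $S(m,k)=\infty$ if there is no such $n$). Then for every integer $m\ge 2$, $$S(m,3)=m^3-m^2-m-1 .$$ -/

import Mathlib

/-- A linear equation `∑ i, coeff i * x i = const` with integer coefficients in the
variables `x i`, `i : ι`. -/
structure LinearEquation (ι : Type) where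
  coeff : ι → ℤ
  const : ℤ

/-- `x` is a solution of the linear equation `E`. -/
def LinearEquation.IsSolution {ι : Type} [Fintype ι] (E : LinearEquation ι) (x : ι → ℤ) : Prop :=
  ∑ i, E.coeff i * x i = E.const

/-- The `k`-coloring `χ` of `[n] = {1, …, n}` induces a monochromatic solution of `E`: there is a
solution with all variables (not necessarily distinct) in `[n]` and of the same color. -/
def HasMonochromaticSolution {ι : Type} [Fintype ι] (E : LinearEquation ι) {k n : ℕ}
    (χ : Set.Icc 1 n → Fin k) : Prop :=
  ∃ x : ι → Set.Icc 1 n, E.IsSolution (fun i => ((x i : ℕ) : ℤ)) ∧ ∃ c : Fin k, ∀ i, χ (x i) = c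

/-- The `k`-color Rado number of `E`: the smallest `n` such that every `k`-coloring of `[n]` induces
a monochromatic solution of `E`, or `⊤` (infinity) if there is no such `n`. -/
noncomputable def radoNumber {ι : Type} [Fintype ι] (k : ℕ) (E : LinearEquation ι) : ℕ∞ :=
  sInf {N : ℕ∞ | ∃ n : ℕ, N = (n : ℕ∞) ∧ ∀ χ : Set.Icc 1 n → Fin k, HasMonochromaticSolution E χ}

/-- The equation `x₁ + ⋯ + x_{m-1} = x_m`, i.e. `x₁ + ⋯ + x_{m-1} - x_m = 0`. The variable `x_j` is
the one with index `j - 1` in `Fin m`. -/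
def schurEquation (m : ℕ) : LinearEquation (Fin m) where
  coeff i := if (i : ℕ) + 1 = m then -1 else 1
  const := 0

theorem schurEquation_isSolution_iff (m : ℕ) (x : Fin (m + 1) → ℤ) :
    (schurEquation (m + 1)).IsSolution x ↔ ∑ i : Fin m, x i.castSucc = x (Fin.last m) := by
  have h : ∀ i : Fin m, (i : ℕ) ≠ m := fun i => i.isLt.ne
  simp [LinearEquation.IsSolution, schurEquation, Fin.sum_univ_castSucc, h, add_neg_eq_zero]

/-- The generalized Schur number `S(m, k) = R_k(x₁ + ⋯ + x_{m-1} = x_m)`. -/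
noncomputable def generalizedSchurNumber (m k : ℕ) : ℕ∞ :=
  radoNumber k (schurEquation m)

/-!
Write `q = m - 1` for the number of summands, so that the claimed value is `q ^ 3 + 2 * q ^ 2 - 2`.

*Lower bound* (`schurFree_extendColoring`). A `k`-colouring of `[1, n]` without monochromatic
solutions extends to a `(k + 1)`-colouring of `[1, T + n]`, where `T + 1 = q * (n + 1)`: give a new
colour to `[n + 1, T]` and repeat the old colouring on `[T + 1, T + n]`. Three steps from the empty
interval reach `q ^ 3 + 2 * q ^ 2 - 3`.

*Upper bound* (`not_schurCover`). For `q = 1` the equation is `x₁ = x₂`. For `q ≥ 2` it suffices to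
use the solutions in which all summands but one, or but two equal ones, agree, that is `z = q * y`,
`z = x + (q - 1) * y` and `z = 2 * x + (q - 2) * y`. They send small polynomials in `q` to small
polynomials in `q`, so a single case analysis on the colours of such polynomials serves every `q`.
The colours of `1` and `q` differ, because `q = q * 1`; call them red and blue, and the third one
green. In each of the three cases for `q ^ 2 + q - 1` (`SchurCover.false_of_red`,
`SchurCover.false_of_blue`, `SchurCover.false_of_green`), a number that would complete a solution in
two of the colours is forced into the third, and after a few branchings some number completes a
solution in its own colour.

In these three proofs `r`, `b` and `g` name memberships in the red, blue and green class, the two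
`fun` terms of a forcing step rule out the other two colours, and `h` stands for a colour that is
refuted on the spot. As polynomials in `q` the numbers have the form
`a * (q ^ 3 - 2 * q ^ 2) + b * (q ^ 2 - 2 * q) + c * (q - 2) + d`, and the bounds needed to stay in the
coloured interval amount to signs of `a`, `b`, `c`, `d`. This is why `linarith` finds them from
`2 ≤ q`, `2 * q ≤ q ^ 2` and `2 * q ^ 2 ≤ q ^ 3`.
-/

/-! ### Colour classes without solutions -/

/-- `S` contains no `y, z` with `z = q * y`, no `x, y, z` with `z = x + (q - 1) * y` and no `x, y, z`
with `z = 2 * x + (q - 2) * y`: these are the solutions of `x₁ + ⋯ + x_q = z` in which all summands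
agree, or all but one, or all but two equal ones. -/
structure AvoidsSums (q : ℤ) (S : Set ℤ) : Prop where
  ne_mul : ∀ y ∈ S, ∀ z ∈ S, z ≠ q * y
  ne_add : ∀ x ∈ S, ∀ y ∈ S, ∀ z ∈ S, z ≠ x + (q - 1) * y
  ne_add_two : ∀ x ∈ S, ∀ y ∈ S, ∀ z ∈ S, z ≠ 2 * x + (q - 2) * y

namespace AvoidsSums

variable {q x y z : ℤ} {S : Set ℤ}

theorem mul (hS : AvoidsSums q S) (hy : y ∈ S) (hz : z ∈ S) (h : z = q * y := by ring) : False :=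
  hS.ne_mul y hy z hz h

theorem add (hS : AvoidsSums q S) (hx : x ∈ S) (hy : y ∈ S) (hz : z ∈ S)
    (h : z = x + (q - 1) * y := by ring) : False :=
  hS.ne_add x hx y hy z hz h

theorem add_two (hS : AvoidsSums q S) (hx : x ∈ S) (hy : y ∈ S) (hz : z ∈ S)
    (h : z = 2 * x + (q - 2) * y := by ring) : False :=
  hS.ne_add_two x hx y hy z hz h

end AvoidsSums

/-- The colour classes of a 3-colouring of `[1, q ^ 3 + 2 * q ^ 2 - 2]` without the monochromatic
solutions excluded by `AvoidsSums`. -/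
structure SchurCover (q : ℤ) (R B G : Set ℤ) : Prop where
  cover : ∀ x : ℤ, 1 ≤ x → x ≤ q ^ 3 + 2 * q ^ 2 - 2 → x ∈ R ∨ x ∈ B ∨ x ∈ G
  red : AvoidsSums q R
  blue : AvoidsSums q B
  green : AvoidsSums q G

namespace SchurCover

variable {q x : ℤ} {R B G : Set ℤ}

theorem cases (H : SchurCover q R B G) (x : ℤ) (h₁ : 1 ≤ x := by linarith)
    (h₂ : x ≤ q ^ 3 + 2 * q ^ 2 - 2 := by linarith) : x ∈ R ∨ x ∈ B ∨ x ∈ G :=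
  H.cover x h₁ h₂

theorem mem_red (H : SchurCover q R B G) (hB : x ∉ B) (hG : x ∉ G) (h₁ : 1 ≤ x := by linarith)
    (h₂ : x ≤ q ^ 3 + 2 * q ^ 2 - 2 := by linarith) : x ∈ R := by
  have := H.cover x h₁ h₂
  tauto

theorem mem_blue (H : SchurCover q R B G) (hR : x ∉ R) (hG : x ∉ G) (h₁ : 1 ≤ x := by linarith)
    (h₂ : x ≤ q ^ 3 + 2 * q ^ 2 - 2 := by linarith) : x ∈ B := by
  have := H.cover x h₁ h₂
  tauto

theorem mem_green (H : SchurCover q R B G) (hR : x ∉ R) (hB : x ∉ B) (h₁ : 1 ≤ x := by linarith)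
    (h₂ : x ≤ q ^ 3 + 2 * q ^ 2 - 2 := by linarith) : x ∈ G := by
  have := H.cover x h₁ h₂
  tauto

end SchurCover

/-! ### The case analysis for three colours -/

/-- The case `q ^ 2 + q - 1` red. With `r1` and `b1` this makes `q ^ 2` green at once; the proof then
branches on `2 * q - 1`. -/
theorem SchurCover.false_of_red {q : ℤ} {R B G : Set ℤ} (H : SchurCover q R B G)
    (hq : 2 ≤ q) (r1 : 1 ∈ R) (b1 : q ∈ B) (r2 : q ^ 2 + q - 1 ∈ R) : False := by
  have hq₂ : 2 * q ≤ q ^ 2 := by nlinarith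
  have hq₃ : 2 * q ^ 2 ≤ q ^ 3 := by nlinarith [sq_nonneg q]
  have g1 : q ^ 2 ∈ G := H.mem_green (fun h => H.red.add h r1 r2) (fun h => H.blue.mul b1 h)
  rcases H.cases (2 * q - 1) with r3 | b2 | g2
  · have b2 : q ^ 3 ∈ B := H.mem_blue (fun h => H.red.add r3 r2 h) (fun h => H.green.mul g1 h)
    have g2 : q ^ 3 + q ^ 2 - q ∈ G := H.mem_green (fun h => H.red.mul r2 h)
      (fun h => H.blue.add b2 b1 h)
    have b3 : 2 * q ^ 2 - q ∈ B := H.mem_blue (fun h => H.red.mul r3 h)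
      (fun h => H.green.add h g1 g2)
    have g3 : 3 * q ^ 2 - 2 * q ∈ G := H.mem_green (fun h => H.red.add r2 r3 h)
      (fun h => H.blue.add b3 b1 h)
    have b4 : 3 * q - 2 ∈ B := H.mem_blue (fun h => H.red.add r3 r1 h) (fun h => H.green.mul h g3)
    have g4 : q ^ 2 + 2 * q - 2 ∈ G := H.mem_green (fun h => H.red.add r2 r1 h)
      (fun h => H.blue.add b4 b1 h)
    have g5 : 2 ∈ G := H.mem_green (fun h => H.red.add r1 h r3) (fun h => H.blue.add b1 h b4)
    exact H.green.add g1 g5 g4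
  · have g2 : q ^ 2 + 2 * q - 2 ∈ G := H.mem_green (fun h => H.red.add r2 r1 h)
      (fun h => H.blue.add_two b2 b1 h)
    rcases H.cases (q ^ 3 + q ^ 2 - q) with h | b3 | g3
    · exact H.red.mul r2 h
    · have r3 : q ^ 3 ∈ R := H.mem_red (fun h => H.blue.add h b1 b3) (fun h => H.green.mul g1 h)
      have r4 : q ^ 3 + 2 * q ^ 2 - 2 * q ∈ R := H.mem_red (fun h => H.blue.add b3 b1 h)
        (fun h => H.green.mul g2 h)
      have g3 : q ^ 2 + 2 * q - 1 ∈ G := H.mem_green (fun h => H.red.add r2 h r4)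
        (fun h => H.blue.add b2 h b3)
      have b4 : q ^ 3 + 2 * q ^ 2 - 3 * q + 1 ∈ B := H.mem_blue (fun h => H.red.add h r1 r4)
        (fun h => H.green.add g1 g3 h)
      have b5 : q ^ 3 + 2 * q ^ 2 - q - 1 ∈ B := H.mem_blue (fun h => H.red.add r4 r1 h)
        (fun h => H.green.add g2 g3 h)
      have r5 : 2 ∈ R := H.mem_red (fun h => H.blue.add b4 h b5) (fun h => H.green.add g1 h g2)
      have r6 : q ^ 3 + 2 * q - 2 ∈ R := H.mem_red (fun h => H.blue.add h b2 b5)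
        (fun h => H.green.add g2 g1 h)
      exact H.red.add r3 r5 r6
    · have r3 : 2 * q ^ 2 - q ∈ R := H.mem_red (fun h => H.blue.mul b2 h)
        (fun h => H.green.add h g1 g3)
      have g4 : 2 * q ^ 2 - 2 * q + 1 ∈ G := H.mem_green (fun h => H.red.add h r1 r3)
        (fun h => H.blue.add b1 b2 h)
      have b3 : q ^ 2 - q + 1 ∈ B := H.mem_blue (fun h => H.red.add_two h r1 r3)
        (fun h => H.green.add_two g4 h g3)
      have b4 : q - 1 ∈ B := H.mem_blue (fun h => H.red.add r2 h r3) (fun h => H.green.add g1 h g4)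
      exact H.blue.add b1 b4 b3
  · rcases H.cases (q ^ 2 + 2 * q - 2) with h | b2 | g3
    · exact H.red.add r2 r1 h
    · have g3 : q + 2 ∈ G := H.mem_green (fun h => H.red.add r1 h r2) (fun h => H.blue.add b1 h b2)
      have r3 : 2 * q ^ 2 + q - 2 ∈ R := H.mem_red (fun h => H.blue.add b2 b1 h)
        (fun h => H.green.add g1 g3 h)
      rcases H.cases (2 * q ^ 2 - 1) with h | b3 | g4
      · exact H.red.add h r1 r3
      · have r4 : q - 1 ∈ R := H.mem_red (fun h => H.blue.add b2 h b3)
          (fun h => H.green.add g2 h g1)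
        have g4 : 3 * q ^ 2 - q - 1 ∈ G := H.mem_green (fun h => H.red.add r3 r4 h)
          (fun h => H.blue.add b3 b1 h)
        have b4 : q ^ 2 + 3 * q - 3 ∈ B := H.mem_blue (fun h => H.red.add h r4 r3)
          (fun h => H.green.add g2 g3 h)
        have b5 : q ^ 3 + 2 * q ^ 2 - q - 1 ∈ B := H.mem_blue (fun h => H.red.add r3 r2 h)
          (fun h => H.green.add g4 g1 h)
        exact H.blue.add b4 b2 b5
      · have r4 : 3 * q - 2 ∈ R := H.mem_red (fun h => H.blue.add h b1 b2)
          (fun h => H.green.add h g2 g4)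
        have b3 : 2 * q ∈ B := H.mem_blue (fun h => H.red.add r4 h r3)
          (fun h => H.green.add g2 h g4)
        have r5 : 2 ∈ R := H.mem_red (fun h => H.blue.mul h b3) (fun h => H.green.add_two h g3 g1)
        have r6 : 2 * q ^ 2 - q ∈ R := H.mem_red (fun h => H.blue.add b1 b3 h)
          (fun h => H.green.mul g2 h)
        exact H.red.add r6 r5 r3
    · have b2 : q ^ 3 - 2 * q + 2 ∈ B := H.mem_blue (fun h => H.red.add r1 r2 h)
        (fun h => H.green.add_two g2 g3 h)
      rcases H.cases (q ^ 3 + q ^ 2 - 2 * q + 1) with r3 | b3 | h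
      · have g4 : q ^ 2 + q - 2 ∈ G := H.mem_green (fun h => H.red.add r2 h r3)
          (fun h => H.blue.add b1 h b2)
        have g5 : q ^ 3 + q ^ 2 - 3 * q + 2 ∈ G := H.mem_green (fun h => H.red.add h r1 r3)
          (fun h => H.blue.add b2 b1 h)
        exact H.green.add g1 g4 g5
      · have r3 : q + 1 ∈ R := H.mem_red (fun h => H.blue.add b2 h b3)
          (fun h => H.green.add g2 h g3)
        have b4 : 2 ∈ B := H.mem_blue (fun h => H.red.add h r1 r3) (fun h => H.green.add g1 h g3)
        have r4 : q ^ 3 ∈ R := H.mem_red (fun h => H.blue.add b2 b4 h) (fun h => H.green.mul g1 h)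
        have g4 : q ^ 3 - q + 1 ∈ G := H.mem_green (fun h => H.red.add h r1 r4)
          (fun h => H.blue.add h b1 b3)
        have r5 : q ^ 2 + q - 2 ∈ R := H.mem_red (fun h => H.blue.add b1 h b2)
          (fun h => H.green.add g2 h g4)
        have b5 : q ^ 2 - 1 ∈ B := H.mem_blue (fun h => H.red.add r2 h r4)
          (fun h => H.green.add g1 h g4)
        have b6 : q - 1 ∈ B := H.mem_blue (fun h => H.red.add h r3 r5)
          (fun h => H.green.add g2 h g1)
        exact H.blue.add b6 b1 b5
      · exact H.green.add g2 g3 h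

/-- The case `q ^ 2 + q - 1` blue. Together with `b1` this excludes blue for `q + 1`, on which the
proof branches. -/
theorem SchurCover.false_of_blue {q : ℤ} {R B G : Set ℤ} (H : SchurCover q R B G)
    (hq : 2 ≤ q) (r1 : 1 ∈ R) (b1 : q ∈ B) (b2 : q ^ 2 + q - 1 ∈ B) : False := by
  have hq₂ : 2 * q ≤ q ^ 2 := by nlinarith
  have hq₃ : 2 * q ^ 2 ≤ q ^ 3 := by nlinarith [sq_nonneg q]
  rcases H.cases (q + 1) with r2 | h | g1
  · have g1 : q ^ 2 ∈ G := H.mem_green (fun h => H.red.add r1 r2 h) (fun h => H.blue.mul b1 h)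
    rcases H.cases (2 * q ^ 2 - 1) with r3 | h | g2
    · have g2 : 3 * q ^ 2 - 2 ∈ G := H.mem_green (fun h => H.red.add r3 r2 h)
        (fun h => H.blue.add_two b2 b1 h)
      have b3 : 2 * q + 2 ∈ B := H.mem_blue (fun h => H.red.add r1 h r3)
        (fun h => H.green.add g1 h g2)
      have g3 : 2 * q ^ 2 + q - 2 ∈ G := H.mem_green (fun h => H.red.add r3 r1 h)
        (fun h => H.blue.add b1 b3 h)
      rcases H.cases (2 * q) with h | b4 | g4
      · exact H.red.add r2 r1 h
      · have g4 : 2 ∈ G := H.mem_green (fun h => H.red.add h r1 r2) (fun h => H.blue.mul h b4)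
        have g5 : 2 * q ^ 2 - q ∈ G := H.mem_green (fun h => H.red.add h r1 r3)
          (fun h => H.blue.add b1 b4 h)
        exact H.green.add g5 g4 g3
      · have b4 : 2 ∈ B := H.mem_blue (fun h => H.red.add h r1 r2) (fun h => H.green.mul h g4)
        have r4 : 3 * q - 2 ∈ R := H.mem_red (fun h => H.blue.add b1 b4 h)
          (fun h => H.green.add h g4 g3)
        have g5 : q ^ 2 + 3 * q - 3 ∈ G := H.mem_green (fun h => H.red.add r4 r2 h)
          (fun h => H.blue.add b2 b4 h)
        have g6 : 2 * q - 1 ∈ G := H.mem_green (fun h => H.red.add r4 h r3)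
          (fun h => H.blue.add h b1 b2)
        exact H.green.add g5 g6 g2
    · exact H.blue.add b2 b1 h
    · rcases H.cases (q ^ 2 + q) with h | b3 | g3
      · exact H.red.mul r2 h
      · have r3 : q ^ 3 + q ^ 2 - 1 ∈ R := H.mem_red (fun h => H.blue.add b2 b3 h)
          (fun h => H.green.add g2 g1 h)
        have r4 : q ^ 3 ∈ R := H.mem_red (fun h => H.blue.add b1 b3 h) (fun h => H.green.mul g1 h)
        exact H.red.add r4 r2 r3
      · have r3 : q ^ 3 + q ^ 2 - q ∈ R := H.mem_red (fun h => H.blue.mul b2 h)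
          (fun h => H.green.add g1 g3 h)
        have b3 : q ^ 3 + q ^ 2 - 1 ∈ B := H.mem_blue (fun h => H.red.add r3 r1 h)
          (fun h => H.green.add g2 g1 h)
        have b4 : q ^ 3 + 2 * q ^ 2 - q - 1 ∈ B := H.mem_blue (fun h => H.red.add r3 r2 h)
          (fun h => H.green.add g2 g3 h)
        exact H.blue.add b3 b1 b4
  · exact H.blue.add b1 h b2
  · rcases H.cases (q ^ 3) with r2 | b3 | g2
    · have g2 : q ^ 2 ∈ G := H.mem_green (fun h => H.red.mul h r2) (fun h => H.blue.mul b1 h)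
      have g3 : q ^ 3 - q + 1 ∈ G := H.mem_green (fun h => H.red.add h r1 r2)
        (fun h => H.blue.add b1 b2 h)
      have r3 : 2 * q ^ 2 - 1 ∈ R := H.mem_red (fun h => H.blue.add b2 b1 h)
        (fun h => H.green.add g2 g1 h)
      have r4 : q ^ 3 + q ^ 2 - q ∈ R := H.mem_red (fun h => H.blue.mul b2 h)
        (fun h => H.green.add g3 g1 h)
      have r5 : q ^ 3 - q ^ 2 - q + 2 ∈ R := H.mem_red (fun h => H.blue.add_two b1 b2 h)
        (fun h => H.green.add h g1 g3)
      have b3 : q ^ 2 - 1 ∈ B := H.mem_blue (fun h => H.red.add r3 h r4)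
        (fun h => H.green.add g2 h g3)
      have g4 : q ^ 3 - q ^ 2 + 1 ∈ G := H.mem_green (fun h => H.red.add r5 r1 h)
        (fun h => H.blue.add b1 b3 h)
      have b4 : q ^ 2 - q - 1 ∈ B := H.mem_blue (fun h => H.red.add r3 h r2)
        (fun h => H.green.add g2 h g4)
      rcases H.cases (q ^ 3 + q - 1) with h | b5 | g5
      · exact H.red.add r2 r1 h
      · have g5 : q ^ 3 + q ^ 2 - 1 ∈ G := H.mem_green (fun h => H.red.add r4 r1 h)
          (fun h => H.blue.add b5 b1 h)
        have g6 : q ^ 2 + q + 1 ∈ G := H.mem_green (fun h => H.red.add r1 h r2)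
          (fun h => H.blue.add b1 h b5)
        exact H.green.add g2 g6 g5
      · have r6 : q ^ 3 - q ^ 2 + q ∈ R := H.mem_red (fun h => H.blue.add b2 b4 h)
          (fun h => H.green.add h g1 g5)
        have b5 : q ^ 2 - q + 1 ∈ B := H.mem_blue (fun h => H.red.mul h r6)
          (fun h => H.green.add h g2 g3)
        have b6 : 2 ∈ B := H.mem_blue (fun h => H.red.add r5 h r6) (fun h => H.green.add g3 h g5)
        exact H.blue.add b5 b6 b2
    · have r2 : q ^ 2 + q ∈ R := H.mem_red (fun h => H.blue.add b1 h b3)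
        (fun h => H.green.mul g1 h)
      have g2 : q ^ 3 - q + 1 ∈ G := H.mem_green (fun h => H.red.add r1 r2 h)
        (fun h => H.blue.add b1 b2 h)
      have r3 : q ^ 3 - q ^ 2 - q + 2 ∈ R := H.mem_red (fun h => H.blue.add_two b1 b2 h)
        (fun h => H.green.add h g1 g2)
      have r4 : q ^ 3 + q ^ 2 - q ∈ R := H.mem_red (fun h => H.blue.mul b2 h)
        (fun h => H.green.add g2 g1 h)
      have g3 : q ^ 2 - 1 ∈ G := H.mem_green (fun h => H.red.add r1 h r3)
        (fun h => H.blue.add b2 h b3)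
      have g4 : q ^ 2 ∈ G := H.mem_green (fun h => H.red.add h r2 r4) (fun h => H.blue.mul b1 h)
      exact H.green.add g4 g3 g2
    · have r2 : q ^ 2 ∈ R := H.mem_red (fun h => H.blue.mul b1 h) (fun h => H.green.mul h g2)
      have b3 : q ^ 3 - q ^ 2 + 1 ∈ B := H.mem_blue (fun h => H.red.add r1 r2 h)
        (fun h => H.green.add h g1 g2)
      rcases H.cases (q ^ 3 + q ^ 2 - 1) with r3 | b4 | h
      · have g3 : 2 * q ^ 2 - 1 ∈ G := H.mem_green (fun h => H.red.add h r2 r3)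
          (fun h => H.blue.add b2 b1 h)
        have g4 : q ^ 3 + q ^ 2 - q ∈ G := H.mem_green (fun h => H.red.add h r1 r3)
          (fun h => H.blue.mul b2 h)
        have r4 : q ^ 2 - 1 ∈ R := H.mem_red (fun h => H.blue.add b1 h b3)
          (fun h => H.green.add g3 h g4)
        have r5 : q ^ 3 - q + 1 ∈ R := H.mem_red (fun h => H.blue.add b1 b2 h)
          (fun h => H.green.add h g1 g4)
        exact H.red.add r2 r4 r5
      · have r3 : q ^ 2 + q ∈ R := H.mem_red (fun h => H.blue.add b2 h b4)
          (fun h => H.green.mul g1 h)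
        have g3 : q ^ 3 + q ^ 2 - q ∈ G := H.mem_green (fun h => H.red.add r2 r3 h)
          (fun h => H.blue.mul b2 h)
        have g4 : q ^ 3 - q + 1 ∈ G := H.mem_green (fun h => H.red.add r1 r3 h)
          (fun h => H.blue.add b1 b2 h)
        exact H.green.add g4 g1 g3
      · exact H.green.add g2 g1 h

/-- The case `q ^ 2 + q - 1` green. The proof branches on `q ^ 3`; if it is green, `q ^ 2` is red, and
`q + 1` is then blue or green. -/
theorem SchurCover.false_of_green {q : ℤ} {R B G : Set ℤ} (H : SchurCover q R B G)
    (hq : 2 ≤ q) (r1 : 1 ∈ R) (b1 : q ∈ B) (g1 : q ^ 2 + q - 1 ∈ G) : False := by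
  have hq₂ : 2 * q ≤ q ^ 2 := by nlinarith
  have hq₃ : 2 * q ^ 2 ≤ q ^ 3 := by nlinarith [sq_nonneg q]
  rcases H.cases (q ^ 3) with r2 | b2 | g2
  · have g2 : q ^ 2 ∈ G := H.mem_green (fun h => H.red.mul h r2) (fun h => H.blue.mul b1 h)
    have b2 : q ^ 3 + q - 1 ∈ B := H.mem_blue (fun h => H.red.add r2 r1 h)
      (fun h => H.green.add g1 g2 h)
    have g3 : q ^ 2 + q + 1 ∈ G := H.mem_green (fun h => H.red.add r1 h r2)
      (fun h => H.blue.add b1 h b2)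
    have r3 : q ^ 3 + q ^ 2 - 1 ∈ R := H.mem_red (fun h => H.blue.add b2 b1 h)
      (fun h => H.green.add g2 g3 h)
    have b3 : q ^ 3 + q ^ 2 + q - 2 ∈ B := H.mem_blue (fun h => H.red.add r3 r1 h)
      (fun h => H.green.add g1 g3 h)
    have b4 : q ^ 3 + q ^ 2 - q ∈ B := H.mem_blue (fun h => H.red.add h r1 r3)
      (fun h => H.green.mul g1 h)
    have r4 : q ^ 3 + 2 * q - 2 ∈ R := H.mem_red (fun h => H.blue.add h b1 b3)
      (fun h => H.green.add_two g1 g2 h)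
    have g4 : q ^ 2 + 2 * q + 2 ∈ G := H.mem_green (fun h => H.red.add r1 h r3)
      (fun h => H.blue.add b1 h b3)
    have g5 : 2 ∈ G := H.mem_green (fun h => H.red.add r2 h r4) (fun h => H.blue.add b4 h b3)
    have g6 : q - 1 ∈ G := H.mem_green (fun h => H.red.add r4 h r3) (fun h => H.blue.add b2 h b4)
    have r5 : q ^ 3 + 2 * q ^ 2 - 2 ∈ R := H.mem_red (fun h => H.blue.add b3 b1 h)
      (fun h => H.green.add_two g3 g4 h)
    have b5 : 2 * q ∈ B := H.mem_blue (fun h => H.red.add r4 h r5) (fun h => H.green.mul g5 h)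
    have r6 : 2 * q ^ 2 - q ∈ R := H.mem_red (fun h => H.blue.add b1 b5 h)
      (fun h => H.green.add g1 g6 h)
    have b6 : 2 * q - 1 ∈ B := H.mem_blue (fun h => H.red.mul h r6) (fun h => H.green.add h g6 g2)
    have b7 : 2 * q ^ 2 - 2 * q + 1 ∈ B := H.mem_blue (fun h => H.red.add h r1 r6)
      (fun h => H.green.add g2 g6 h)
    exact H.blue.add b1 b6 b7
  · have r2 : q ^ 3 + q ^ 2 - q ∈ R := H.mem_red (fun h => H.blue.add b2 b1 h)
      (fun h => H.green.mul g1 h)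
    rcases H.cases (q ^ 2 + q) with r3 | h | g2
    · have g2 : q ^ 2 ∈ G := H.mem_green (fun h => H.red.add h r3 r2) (fun h => H.blue.mul b1 h)
      have b3 : q ^ 3 + q ^ 2 - 2 * q + 1 ∈ B := H.mem_blue (fun h => H.red.add h r1 r2)
        (fun h => H.green.add g2 g1 h)
      have g3 : q ^ 3 - q + 1 ∈ G := H.mem_green (fun h => H.red.add r1 r3 h)
        (fun h => H.blue.add h b1 b3)
      have g4 : q ^ 2 + 2 * q - 1 ∈ G := H.mem_green (fun h => H.red.add r3 r1 h)
        (fun h => H.blue.add b1 h b3)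
      have r4 : q ^ 3 + 2 * q ^ 2 - 3 * q + 1 ∈ R := H.mem_red (fun h => H.blue.add b3 b1 h)
        (fun h => H.green.add g2 g4 h)
      have g5 : q - 1 ∈ G := H.mem_green (fun h => H.red.add r2 h r4) (fun h => H.blue.add b2 h b3)
      have b4 : 2 * q ^ 2 - 2 * q + 1 ∈ B := H.mem_blue (fun h => H.red.add h r3 r4)
        (fun h => H.green.add g2 g5 h)
      have r5 : q ^ 3 - q ^ 2 + q ∈ R := H.mem_red (fun h => H.blue.add h b1 b2)
        (fun h => H.green.add h g5 g3)
      have r6 : q ^ 2 - q + 1 ∈ R := H.mem_red (fun h => H.blue.add h b1 b4)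
        (fun h => H.green.add h g2 g3)
      exact H.red.mul r6 r5
    · exact H.blue.add b1 h b2
    · have b3 : q ^ 3 + q ^ 2 - 1 ∈ B := H.mem_blue (fun h => H.red.add r2 r1 h)
        (fun h => H.green.add g1 g2 h)
      have g3 : q ^ 2 + 2 * q + 1 ∈ G := H.mem_green (fun h => H.red.add r1 h r2)
        (fun h => H.blue.add b1 h b3)
      have r3 : q + 1 ∈ R := H.mem_red (fun h => H.blue.add b2 h b3) (fun h => H.green.mul h g2)
      have g4 : q ^ 2 ∈ G := H.mem_green (fun h => H.red.add r1 r3 h) (fun h => H.blue.mul b1 h)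
      have g5 : q ^ 3 + 2 * q ^ 2 - q - 1 ∈ G := H.mem_green (fun h => H.red.add r2 r3 h)
        (fun h => H.blue.add b3 b1 h)
      exact H.green.add g4 g3 g5
  · have r2 : q ^ 2 ∈ R := H.mem_red (fun h => H.blue.mul b1 h) (fun h => H.green.mul h g2)
    rcases H.cases (q + 1) with h | b2 | g3
    · exact H.red.add r1 h r2
    · rcases H.cases (q ^ 2 + q) with r3 | h | g3
      · have g3 : q ^ 2 + 1 ∈ G := H.mem_green (fun h => H.red.add h r1 r3)
          (fun h => H.blue.add b2 b1 h)
        have b3 : q ^ 3 + q ∈ B := H.mem_blue (fun h => H.red.add r3 r2 h)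
          (fun h => H.green.mul g3 h)
        have b4 : q ^ 2 - q + 1 ∈ B := H.mem_blue (fun h => H.red.add h r1 r2)
          (fun h => H.green.add h g3 g2)
        have g4 : q ^ 3 + q ^ 2 ∈ G := H.mem_green (fun h => H.red.mul r3 h)
          (fun h => H.blue.add b3 b1 h)
        have b5 : q ^ 2 + 2 * q - 1 ∈ B := H.mem_blue (fun h => H.red.add r3 r1 h)
          (fun h => H.green.add h g1 g4)
        have r4 : 2 * q ^ 2 - q + 1 ∈ R := H.mem_red (fun h => H.blue.add h b4 b3)
          (fun h => H.green.add h g3 g4)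
        have r5 : q ^ 3 + q ^ 2 - 2 * q + 2 ∈ R := H.mem_red (fun h => H.blue.add b2 b5 h)
          (fun h => H.green.add g3 g1 h)
        have r6 : q ^ 2 - 1 ∈ R := H.mem_red (fun h => H.blue.add b5 h b3)
          (fun h => H.green.add g1 h g2)
        exact H.red.add r4 r6 r5
      · exact H.blue.mul b2 h
      · rcases H.cases (2 * q ^ 2 - q) with r3 | b3 | g4
        · have b3 : 2 * q - 1 ∈ B := H.mem_blue (fun h => H.red.mul h r3)
            (fun h => H.green.add h g1 g2)
          have b4 : q ^ 3 + q ^ 2 - q ∈ B := H.mem_blue (fun h => H.red.add r3 r2 h)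
            (fun h => H.green.mul g1 h)
          have g4 : 2 * q ^ 2 - 2 * q + 1 ∈ G := H.mem_green (fun h => H.red.add h r1 r3)
            (fun h => H.blue.add b1 b3 h)
          have g5 : q ^ 3 + 2 * q ^ 2 - 2 * q ∈ G := H.mem_green (fun h => H.red.add_two r3 r2 h)
            (fun h => H.blue.add b4 b1 h)
          have b5 : q ^ 2 - q + 1 ∈ B := H.mem_blue (fun h => H.red.add h r1 r2)
            (fun h => H.green.add g4 h g2)
          have r4 : q ^ 2 + 2 * q ∈ R := H.mem_red (fun h => H.blue.add b1 h b4)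
            (fun h => H.green.add_two g3 h g5)
          have r5 : q ^ 2 + q + 1 ∈ R := H.mem_red (fun h => H.blue.add b5 h b4)
            (fun h => H.green.add g4 h g5)
          exact H.red.add r5 r1 r4
        · have r3 : 2 * q - 1 ∈ R := H.mem_red (fun h => H.blue.mul h b3)
            (fun h => H.green.add h g1 g2)
          have g4 : q ^ 2 - q + 1 ∈ G := H.mem_green (fun h => H.red.add h r1 r2)
            (fun h => H.blue.add h b2 b3)
          have r4 : q ^ 2 + 1 ∈ R := H.mem_red (fun h => H.blue.add b2 b1 h)
            (fun h => H.green.add g4 h g2)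
          have b4 : 2 ∈ B := H.mem_blue (fun h => H.red.add r1 h r3) (fun h => H.green.add g4 h g1)
          have b5 : q ^ 3 - q ^ 2 + q ∈ B := H.mem_blue (fun h => H.red.add r1 r4 h)
            (fun h => H.green.mul g4 h)
          have b6 : q ^ 3 - q ^ 2 + 3 * q - 2 ∈ B := H.mem_blue (fun h => H.red.add r3 r4 h)
            (fun h => H.green.add g1 g4 h)
          exact H.blue.add b5 b4 b6
        · rcases H.cases (q ^ 3 + q ^ 2 - q) with r3 | b3 | h
          · have b3 : q ^ 3 + q ^ 2 - 1 ∈ B := H.mem_blue (fun h => H.red.add r3 r1 h)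
              (fun h => H.green.add g1 g3 h)
            have g5 : q ^ 2 + 2 * q + 1 ∈ G := H.mem_green (fun h => H.red.add r1 h r3)
              (fun h => H.blue.add b1 h b3)
            have r4 : q ^ 3 + 2 * q ^ 2 - 2 ∈ R := H.mem_red (fun h => H.blue.add b3 b2 h)
              (fun h => H.green.add g1 g5 h)
            have g6 : q ^ 3 + 2 * q ^ 2 - q - 1 ∈ G := H.mem_green (fun h => H.red.add h r1 r4)
              (fun h => H.blue.add b3 b1 h)
            have b4 : 2 * q ^ 2 - 1 ∈ B := H.mem_blue (fun h => H.red.add_two h r2 r4)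
              (fun h => H.green.add h g3 g6)
            have g7 : 3 * q ^ 2 - 2 ∈ G := H.mem_green (fun h => H.red.add h r2 r4)
              (fun h => H.blue.add b4 b2 h)
            have r5 : 2 * q + 1 ∈ R := H.mem_red (fun h => H.blue.add b1 h b4)
              (fun h => H.green.add g2 h g6)
            have b5 : q + 2 ∈ B := H.mem_blue (fun h => H.red.add r3 h r4)
              (fun h => H.green.add g4 h g7)
            have g8 : q ^ 3 + q - 1 ∈ G := H.mem_green (fun h => H.red.add h r5 r4)
              (fun h => H.blue.add h b1 b3)
            have g9 : q ^ 2 - q + 1 ∈ G := H.mem_green (fun h => H.red.add h r1 r2)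
              (fun h => H.blue.add h b5 b4)
            exact H.green.add g4 g9 g8
          · have r3 : q ^ 3 + 2 * q ^ 2 - 2 * q ∈ R := H.mem_red (fun h => H.blue.add b3 b1 h)
              (fun h => H.green.add g4 g3 h)
            have g5 : q ^ 2 + 2 * q ∈ G := H.mem_green (fun h => H.red.add r2 h r3)
              (fun h => H.blue.add b1 h b3)
            have g6 : q ^ 3 + 2 * q ^ 2 - q - 1 ∈ G := H.mem_green (fun h => H.red.add r3 r1 h)
              (fun h => H.blue.add b3 b2 h)
            exact H.green.add g1 g5 g6
          · exact H.green.mul g1 h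
    · have b2 : 2 * q ^ 2 + q - 2 ∈ B := H.mem_blue (fun h => H.red.add_two r2 r1 h)
        (fun h => H.green.add g1 g3 h)
      have b3 : q ^ 3 - q ^ 2 + 1 ∈ B := H.mem_blue (fun h => H.red.add r1 r2 h)
        (fun h => H.green.add h g3 g2)
      have r3 : q ^ 2 - 1 ∈ R := H.mem_red (fun h => H.blue.add b1 h b3)
        (fun h => H.green.add g1 h g2)
      have g4 : q ^ 3 - q + 1 ∈ G := H.mem_green (fun h => H.red.add r2 r3 h)
        (fun h => H.blue.add b3 b1 h)
      have b4 : q ^ 3 - q ^ 2 - q + 2 ∈ B := H.mem_blue (fun h => H.red.add r1 r3 h)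
        (fun h => H.green.add h g3 g4)
      have g5 : q ^ 3 - 2 * q ^ 2 + 2 ∈ G := H.mem_green (fun h => H.red.add_two r1 r2 h)
        (fun h => H.blue.add h b1 b4)
      have r4 : q ^ 2 - 2 ∈ R := H.mem_red (fun h => H.blue.add b1 h b4)
        (fun h => H.green.add g1 h g4)
      have r5 : 2 * q + 2 ∈ R := H.mem_red (fun h => H.blue.add b1 h b2)
        (fun h => H.green.add g5 h g2)
      have g6 : q ^ 3 - 2 * q + 2 ∈ G := H.mem_green (fun h => H.red.add_two r3 r4 h)
        (fun h => H.blue.add b4 b1 h)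
      have g7 : 3 * q ^ 2 - 2 ∈ G := H.mem_green (fun h => H.red.add r2 r5 h)
        (fun h => H.blue.add b2 b1 h)
      have b5 : q ^ 3 - q ^ 2 - 2 * q + 3 ∈ B := H.mem_blue (fun h => H.red.add r1 r4 h)
        (fun h => H.green.add h g3 g6)
      have b6 : 2 * q ^ 2 - 1 ∈ B := H.mem_blue (fun h => H.red.add r1 r5 h)
        (fun h => H.green.add h g3 g7)
      have r6 : 2 ∈ R := H.mem_red (fun h => H.blue.add b5 h b3) (fun h => H.green.add g6 h g2)
      have b7 : 2 * q ∈ B := H.mem_blue (fun h => H.red.mul r6 h) (fun h => H.green.add g5 h g6)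
      have b8 : 2 * q - 1 ∈ B := H.mem_blue (fun h => H.red.add r1 r6 h)
        (fun h => H.green.add h g1 g2)
      exact H.blue.add b8 b7 b6

/-- A 3-colouring in which `1` and `q` have different colours leaves no room for a third one. -/
theorem not_schurCover {q : ℤ} {R B G : Set ℤ} (hq : 2 ≤ q) (r1 : 1 ∈ R) (b1 : q ∈ B) :
    ¬ SchurCover q R B G := by
  intro H
  rcases H.cases (q ^ 2 + q - 1) (by nlinarith) (by nlinarith [sq_nonneg q]) with h | h | h
  · exact H.false_of_red hq r1 b1 h
  · exact H.false_of_blue hq r1 b1 h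
  · exact H.false_of_green hq r1 b1 h

/-! ### The upper bound -/

/-- The numbers of colour `c`, as a set of integers. -/
def colorClass {n k : ℕ} (χ : Set.Icc 1 n → Fin k) (c : Fin k) : Set ℤ :=
  {z | ∃ a : Set.Icc 1 n, ((a : ℕ) : ℤ) = z ∧ χ a = c}

theorem HasMonochromaticSolution.of_two_summands {q n k : ℕ} {χ : Set.Icc 1 n → Fin k} {c : Fin k}
    (j : ℕ) (hj : j ≤ q) {x y z : ℤ} (hx : x ∈ colorClass χ c) (hy : y ∈ colorClass χ c)
    (hz : z ∈ colorClass χ c) (h : z = j * x + (q - j) * y) :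
    HasMonochromaticSolution (schurEquation (q + 1)) χ := by
  obtain ⟨a, rfl, ha⟩ := hx
  obtain ⟨b, rfl, hb⟩ := hy
  obtain ⟨d, rfl, hd⟩ := hz
  refine ⟨Fin.snoc (α := fun _ => Set.Icc 1 n) (fun i : Fin q => if (i : ℕ) < j then a else b) d,
    (schurEquation_isSolution_iff q _).2 ?_, c, fun i => ?_⟩
  · obtain ⟨l, rfl⟩ := Nat.exists_eq_add_of_le hj
    simp only [Fin.snoc_castSucc, Fin.snoc_last, Fin.sum_univ_add]
    simp [h]
  · refine Fin.lastCases ?_ (fun i => ?_) i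
    · simpa using hd
    · simp only [Fin.snoc_castSucc]
      split_ifs <;> assumption

theorem avoidsSums_colorClass {q n k : ℕ} (hq : 2 ≤ q) {χ : Set.Icc 1 n → Fin k}
    (hχ : ¬ HasMonochromaticSolution (schurEquation (q + 1)) χ) (c : Fin k) :
    AvoidsSums q (colorClass χ c) where
  ne_mul y hy z hz h := hχ (.of_two_summands 0 (by omega) hy hy hz (by simpa using h))
  ne_add x hx y hy z hz h := hχ (.of_two_summands 1 (by omega) hx hy hz (by simpa using h))
  ne_add_two x hx y hy z hz h := hχ (.of_two_summands 2 hq hx hy hz (by simpa using h))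

theorem hasMonochromaticSolution_three {q n : ℕ} (hq : 1 ≤ q) (hn : n + 2 = q ^ 3 + 2 * q ^ 2)
    (χ : Set.Icc 1 n → Fin 3) : HasMonochromaticSolution (schurEquation (q + 1)) χ := by
  have hcast : (n : ℤ) = q ^ 3 + 2 * q ^ 2 - 2 := by
    have : ((n + 2 : ℕ) : ℤ) = ((q ^ 3 + 2 * q ^ 2 : ℕ) : ℤ) := by rw [hn]
    push_cast at this
    linarith
  have mem : ∀ z : ℤ, 1 ≤ z → z ≤ q ^ 3 + 2 * q ^ 2 - 2 → ∃ c, z ∈ colorClass χ c := by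
    intro z h₁ h₂
    lift z to ℕ using by omega
    exact ⟨_, ⟨z, by constructor <;> omega⟩, rfl, rfl⟩
  have hq₃ : (q : ℤ) + 2 ≤ q ^ 3 + 2 * q ^ 2 := by
    have : (1 : ℤ) ≤ q := by exact_mod_cast hq
    nlinarith [sq_nonneg (q : ℤ), pow_pos (show (0 : ℤ) < q by linarith) 3]
  obtain ⟨c₀, h₀⟩ := mem 1 le_rfl (by linarith [Int.natCast_nonneg q])
  -- for `q = 1` the equation reads `x₁ = x₂`
  obtain rfl | hq := hq.eq_or_lt
  · exact .of_two_summands 0 (by omega) h₀ h₀ h₀ (by simp)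
  by_contra hχ
  obtain ⟨c₁, h₁⟩ := mem q (by exact_mod_cast hq.le) (by linarith)
  have hne : c₀ ≠ c₁ := by
    rintro rfl
    exact (avoidsSums_colorClass hq hχ c₀).mul h₀ h₁
  obtain ⟨c₂, h₂⟩ : ∃ c₂ : Fin 3, ∀ c, c = c₀ ∨ c = c₁ ∨ c = c₂ := by
    revert hne
    clear * -
    revert c₀ c₁
    decide
  refine not_schurCover (by exact_mod_cast hq) h₀ h₁ (G := colorClass χ c₂) ⟨fun z hz hz' => ?_,
    avoidsSums_colorClass hq hχ c₀, avoidsSums_colorClass hq hχ c₁, avoidsSums_colorClass hq hχ c₂⟩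
  obtain ⟨c, hc⟩ := mem z hz hz'
  obtain rfl | rfl | rfl := h₂ c
  exacts [.inl hc, .inr (.inl hc), .inr (.inr hc)]

/-! ### The lower bound -/

/-- No `q` numbers and their sum, all positive and the sum at most `n`, have the same colour. -/
def SchurFree (q n : ℕ) (χ : ℕ → ℕ) : Prop :=
  ∀ (x : Fin q → ℕ) (c : ℕ), (∀ i, 1 ≤ x i ∧ χ (x i) = c) → χ (∑ i, x i) = c → n < ∑ i, x i

/-- The colouring `χ` of `[1, n]`, then an interval of the new colour `k` up to `T`, then the
translate of `χ` to `[T + 1, T + n]`. -/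
def extendColoring (n T k : ℕ) (χ : ℕ → ℕ) (x : ℕ) : ℕ :=
  if x ≤ n then χ x else if x ≤ T then k else χ (x - T)

/-- The new colour is sum-free because any `q` of its elements add up to more than `T`. Old colours
produce no new solution either: if no summand exceeds `T`, the sum is at most `q * n ≤ T`, and if one does,
it is the only one, so that `T` can be subtracted from it and from the sum. -/
theorem schurFree_extendColoring {q n k T : ℕ} {χ : ℕ → ℕ} (hq : 1 ≤ q)
    (hT : T + 1 = q * (n + 1)) (hχ : SchurFree q n χ) (hk : ∀ x, 1 ≤ x → x ≤ n → χ x < k) :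
    SchurFree q (T + n) (extendColoring n T k χ) := by
  have hnT : n ≤ T := by nlinarith
  intro x c hx hs
  by_contra! hle
  have hxs : ∀ i, x i ≤ ∑ i, x i := fun i =>
    Finset.single_le_sum (fun _ _ => Nat.zero_le _) (Finset.mem_univ i)
  by_cases hup : ∃ i, T < x i
  · obtain ⟨i, hi⟩ := hup
    have hsplit := Finset.add_sum_erase Finset.univ x (Finset.mem_univ i)
    have hsmall : ∀ j, j ≠ i → x j ≤ n := by
      intro j hj
      have : x j ≤ ∑ j ∈ Finset.univ.erase i, x j :=
        Finset.single_le_sum (f := x) (fun _ _ => Nat.zero_le _) (by simp [hj])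
      omega
    set y : Fin q → ℕ := Function.update x i (x i - T) with hy
    have hsum : ∑ j, y j + T = ∑ j, x j := by
      rw [← Finset.add_sum_erase Finset.univ y (Finset.mem_univ i), ← hsplit,
        Finset.sum_congr (g := fun j => x j) rfl fun j hj =>
          Function.update_of_ne (Finset.ne_of_mem_erase hj) _ x]
      simp only [hy, Function.update_self]
      omega
    have hyc : ∀ j, 1 ≤ y j ∧ χ (y j) = c := by
      intro j
      obtain ⟨h₁, h₂⟩ := hx j
      by_cases hj : j = i
      · subst hj
        simp only [hy, Function.update_self]
        rw [extendColoring, if_neg (by omega), if_neg (by omega)] at h₂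
        exact ⟨by omega, h₂⟩
      · simp only [hy, Function.update_of_ne hj]
        rw [extendColoring, if_pos (hsmall j hj)] at h₂
        exact ⟨h₁, h₂⟩
    have hi' := hxs i
    rw [extendColoring, if_neg (by omega), if_neg (by omega), ← hsum,
      Nat.add_sub_cancel] at hs
    have := hχ y c hyc hs
    omega
  · push Not at hup
    by_cases hc : c = k
    · -- the new colour occupies `[n + 1, T]`, too short an interval
      have hbig : ∀ i, n + 1 ≤ x i := by
        intro i
        by_contra! h
        obtain ⟨h₁, h₂⟩ := hx i
        rw [extendColoring, if_pos (by omega)] at h₂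
        have := hk (x i) h₁ (by omega)
        omega
      have hTs : T + 1 ≤ ∑ i, x i := by
        have := Finset.card_nsmul_le_sum Finset.univ x (n + 1) fun i _ => hbig i
        simpa [hT] using this
      rw [extendColoring, if_neg (by omega), if_neg (by omega)] at hs
      have := hk (∑ i, x i - T) (by omega) (by omega)
      omega
    · have hsmall : ∀ i, x i ≤ n := by
        intro i
        by_contra! h
        obtain ⟨h₁, h₂⟩ := hx i
        rw [extendColoring, if_neg (by omega), if_pos (hup i)] at h₂
        exact hc h₂.symm
      have hsT : ∑ i, x i ≤ T := by
        have := Finset.sum_le_card_nsmul Finset.univ x n fun i _ => hsmall i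
        simp only [Finset.card_univ, Fintype.card_fin, smul_eq_mul] at this
        rw [mul_add] at hT
        linarith
      by_cases hsn : ∑ i, x i ≤ n
      · rw [extendColoring, if_pos hsn] at hs
        refine absurd (hχ x c (fun i => ⟨(hx i).1, ?_⟩) hs) (by omega)
        have := (hx i).2
        rwa [extendColoring, if_pos (hsmall i)] at this
      · rw [extendColoring, if_neg hsn, if_pos hsT] at hs
        exact hc hs.symm

/-- The length of the `k`-coloured interval without monochromatic solutions that iterating
`extendColoring` yields for `q` summands. -/
def schurBound (q : ℕ) : ℕ → ℕ
  | 0 => 0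
  | k + 1 => q * (schurBound q k + 1) - 1 + schurBound q k

theorem exists_schurFree {q : ℕ} (hq : 1 ≤ q) (k : ℕ) : ∃ χ : ℕ → ℕ,
    SchurFree q (schurBound q k) χ ∧ ∀ x, 1 ≤ x → x ≤ schurBound q k → χ x < k := by
  induction k with
  | zero =>
    refine ⟨fun _ => 0, fun x c hx _ => ?_, fun x h₁ h₂ => ?_⟩
    · exact Finset.sum_pos (fun i _ => (hx i).1) ⟨⟨0, hq⟩, Finset.mem_univ _⟩
    · simp only [schurBound] at h₂
      omega
  | succ k ih =>
    obtain ⟨χ, hχ, hk⟩ := ih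
    have hT : q * (schurBound q k + 1) - 1 + 1 = q * (schurBound q k + 1) :=
      Nat.sub_add_cancel (Nat.mul_pos hq (Nat.succ_pos _))
    refine ⟨_, schurFree_extendColoring hq hT hχ hk, fun x h₁ h₂ => ?_⟩
    simp only [schurBound] at h₂
    unfold extendColoring
    split_ifs with h h'
    · exact (hk x h₁ h).trans (Nat.lt_succ_self k)
    · exact Nat.lt_succ_self k
    · exact (hk (x - _) (by omega) (by omega)).trans (Nat.lt_succ_self k)

theorem exists_not_hasMonochromaticSolution {q k n : ℕ} (hq : 1 ≤ q) (hn : n ≤ schurBound q k) :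
    ∃ χ : Set.Icc 1 n → Fin k, ¬ HasMonochromaticSolution (schurEquation (q + 1)) χ := by
  obtain ⟨χ, hχ, hk⟩ := exists_schurFree hq k
  refine ⟨fun a => ⟨χ a, hk a a.2.1 (a.2.2.trans hn)⟩, ?_⟩
  rintro ⟨x, hx, c, hc⟩
  rw [schurEquation_isSolution_iff] at hx
  have hx' : ∑ i : Fin q, (x i.castSucc : ℕ) = x (Fin.last q) := by exact_mod_cast hx
  have hc' : ∀ i, χ (x i) = c := fun i => congrArg Fin.val (hc i)
  have := hχ (fun i => x i.castSucc) c (fun i => ⟨(x i.castSucc).2.1, hc' _⟩)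
    (by rw [hx']; exact hc' _)
  have h₂ := (x (Fin.last q)).2.2
  omega

theorem schurBound_three {q : ℕ} (hq : 1 ≤ q) : schurBound q 3 + 3 = q ^ 3 + 2 * q ^ 2 := by
  obtain ⟨t, rfl⟩ := Nat.exists_eq_add_of_le' hq
  have h₁ : schurBound (t + 1) 1 = t := by simp [schurBound]
  have h₂ : schurBound (t + 1) 2 = (t + 1) * (t + 1) + t - 1 := by
    rw [schurBound, h₁]
    have : 1 ≤ (t + 1) * (t + 1) := Nat.mul_pos t.succ_pos t.succ_pos
    omega
  have h₂' : schurBound (t + 1) 2 + 1 = (t + 1) * (t + 1) + t := by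
    have : 1 ≤ (t + 1) * (t + 1) := Nat.mul_pos t.succ_pos t.succ_pos
    omega
  have h₃ : schurBound (t + 1) 3 + 2 =
      (t + 1) * ((t + 1) * (t + 1) + t) + ((t + 1) * (t + 1) + t) := by
    rw [schurBound, h₂']
    have : 1 ≤ (t + 1) * ((t + 1) * (t + 1) + t) := Nat.mul_pos t.succ_pos (by positivity)
    omega
  nlinarith

/-! ### The Schur number for three colours -/

theorem corollary1p3 (m : ℕ) (hm : 2 ≤ m) :
    ∃ n : ℕ, generalizedSchurNumber m 3 = (n : ℕ∞) ∧
      (n : ℤ) = (m : ℤ) ^ 3 - (m : ℤ) ^ 2 - (m : ℤ) - 1 := by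
  obtain ⟨q, rfl⟩ := Nat.exists_eq_add_of_le' (one_le_two.trans hm)
  have hq : 1 ≤ q := by omega
  have hb := schurBound_three hq
  refine ⟨schurBound q 3 + 1, ?_, ?_⟩
  · refine IsLeast.csInf_eq ⟨⟨_, rfl, hasMonochromaticSolution_three hq (by omega)⟩, ?_⟩
    rintro _ ⟨n, rfl, hn⟩
    by_contra! hlt
    obtain ⟨χ, hχ⟩ := exists_not_hasMonochromaticSolution hq
      (Nat.lt_succ_iff.1 (by exact_mod_cast hlt : n < schurBound q 3 + 1))
    exact hχ (hn χ)
  · have : ((schurBound q 3 + 3 : ℕ) : ℤ) = ((q ^ 3 + 2 * q ^ 2 : ℕ) : ℤ) := by rw [hb]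
    push_cast at this ⊢
    linarith
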